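/- A hypergraph on a finite linearly ordered vertex set $S$ is a family of subsets of $S$, called hyperedges. It is ABA-free if it has no two hyperedges $F,G$ and vertices $x<y<z$ with $x,z\in F\setminus G$ and $y\in G\setminus F$. A hypergraph $\mathcal H$ on $S$ is a pseudohalfplane hypergraph if there is an ABA-free hypergraph $\mathcal F$ on $S$ (with the same order) such that every hyperedge of $\mathcal H$ is a hyperedge of $\mathcal F$ or the complement $S\setminus F$ of a hyperedge $F$ of $\mathcal F$. An extension of $\mathcal H$ is a pseudohalfplane hypergraph on the same ordered vertex set $S$ whose family of hyperedges properly contains that of $\mathcal H$. For disjoint sets $A,B\subseteq S$, a set $X\subseteq S$ separates $A$ and $B$ if $A\subseteq X$ and $X\cap B=\emptyset$, or $X\cap A=\emptyset$ and $B\subseteq X$. **Theorem (Kirchberger's theorem for pseudoconvex sets).** Let $\mathcal H$ be a pseudohalfplane hypergraph on a finite linearly ordered vertex set $S$ and let $A,B\subseteq S$. Suppose that for every $D\subseteq S$ with $|D|\le 4$ the sets $A\cap D$ and $B\cap D$ are disjoint and some hyperedge of $\mathcal H$ separates them. Then either some hyperedge of $\mathcal H$ already separates $A$ and $B$, or there is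 a set $X\subseteq S$ that is not a hyperedge of $\mathcal H$ such that $\mathcal H\cup\{X\}$ is an extension of $\mathcal H$ and $X$ separates $A$ and $B$. (In particular $A\cap B=\emptyset$.) -/

import Mathlib

namespace Hypergraph

/-- A hypergraph whose vertices are ordered by the linear order of `α` is ABA-free if there are no
two hyperedges `A`, `B` and vertices `x < y < z` with `x, z ∈ A \ B` and `y ∈ B \ A`. -/
def IsABAFree {α : Type*} [LinearOrder α] (F : Hypergraph α) : Prop :=
  ¬ ∃ A ∈ F.edgeSet, ∃ B ∈ F.edgeSet, ∃ x ∈ A \ B, ∃ y ∈ B \ A, ∃ z ∈ A \ B, x < y ∧ y < z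

/-- The hypergraph on the same vertex set whose hyperedges are the complements (within the vertex
set) of the hyperedges of `F`. -/
def complements {α : Type*} (F : Hypergraph α) : Hypergraph α where
  vertexSet := F.vertexSet
  edgeSet := (fun A => F.vertexSet \ A) '' F.edgeSet
  subset_vertexSet_of_mem_edgeSet' := by
    rintro _ ⟨A, _, rfl⟩
    exact Set.sdiff_subset

/-- `H` is a pseudohalfplane hypergraph (for the vertex order inherited from `α`) if each of its
hyperedges is a hyperedge of `F`, or the complement of one, for a single ABA-free hypergraph `F`
on the same vertex set. -/
def IsPseudohalfplane {α : Type*} [LinearOrder α] (H : Hypergraph α) : Prop :=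
  ∃ F : Hypergraph α, F.vertexSet = H.vertexSet ∧ F.IsABAFree ∧
    H.edgeSet ⊆ F.edgeSet ∪ F.complements.edgeSet

/-- `H'` is an extension (by hyperedges) of `H`: it is a pseudohalfplane hypergraph on the same
ordered vertex set, and the hyperedges of `H` form a proper subfamily of those of `H'`. -/
def IsExtension {α : Type*} [LinearOrder α] (H H' : Hypergraph α) : Prop :=
  H'.IsPseudohalfplane ∧ H'.vertexSet = H.vertexSet ∧ H.edgeSet ⊂ H'.edgeSet

end Hypergraph

/-- `X` separates the disjoint sets `A` and `B`: it contains one of them and avoids the other. -/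
def Separates {α : Type*} (X A B : Set α) : Prop :=
  A ∩ B = ∅ ∧ ((A ⊆ X ∧ X ∩ B = ∅) ∨ (X ∩ A = ∅ ∧ B ⊆ X))

/-! Fix an ABA-free family `𝓕` that witnesses pseudohalfplanarity. On `T = A ∪ B` the only
obstruction to adding `A` is an alternating triple on which some member of `𝓕` is opposite to `A`;
the only obstruction to adding `Aᶜ` is one on which some member agrees with `A`. Both cannot occur.
Members that agree and disagree on the same triple would form an ABA, so by the four-vertex
hypothesis agreement on one alternating triple survives the addition of any fourth vertex, and
exchanging vertices one at a time carries it to every alternating triple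
(`Realizes.of_isAlternating`). Hence `A` or `Aᶜ` is compatible on `T`.

A compatible set then extends over the remaining vertices one by one (`CompatibleOn.exists_insert`),
which gives the separating hyperedge. -/

/-- `F` and `G` do not alternate three times along vertices of `T`, with `F` on the outside. -/
def NoAlternation {α : Type*} [LinearOrder α] (T F G : Set α) : Prop :=
  ∀ x ∈ T, ∀ y ∈ T, ∀ z ∈ T, x < y → y < z →
    x ∈ F → x ∉ G → y ∈ G → y ∉ F → z ∈ F → z ∉ G → False

/-- On the vertices of `T`, the set `X` can be added to the family `𝓕` without creating an
ABA-pattern. -/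
def CompatibleOn {α : Type*} [LinearOrder α] (𝓕 : Set (Set α)) (T X : Set α) : Prop :=
  ∀ F ∈ 𝓕, NoAlternation T F X ∧ NoAlternation T X F

theorem NoAlternation.mono {α : Type*} [LinearOrder α] {T T' F G : Set α}
    (h : NoAlternation T F G) (hT : T' ⊆ T) : NoAlternation T' F G :=
  fun x hx y hy z hz => h x (hT hx) y (hT hy) z (hT hz)

/-! ### Extending a compatible set vertex by vertex -/

/-- Since there is no pattern inside `T`, a new one must use `p`; the three disjuncts record whether
`p` is its middle, first or last vertex. -/
theorem exists_alternation_of_not_mem {α : Type*} [LinearOrder α] {T X F : Set α} {p : α}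
    (hFX : NoAlternation T F X) (hXF : NoAlternation T X F) (hp : p ∉ T)
    (h : ¬ (NoAlternation (insert p T) F (X \ {p}) ∧ NoAlternation (insert p T) (X \ {p}) F)) :
    p ∈ F ∧ ∃ u ∈ T, ∃ v ∈ T, u ∈ X ∧ u ∉ F ∧
      ((u < p ∧ p < v ∧ v ∈ X ∧ v ∉ F) ∨ (p < u ∧ u < v ∧ v ∈ F ∧ v ∉ X) ∨
        (v < u ∧ u < p ∧ v ∈ F ∧ v ∉ X)) := by
  unfold NoAlternation at *
  rw [not_and_or] at h
  push Not at h
  simp only [Set.mem_insert_iff, Set.mem_sdiff, Set.mem_singleton_iff] at h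
  rcases h with ⟨x, hx, y, hy, z, hz, h⟩ | ⟨x, hx, y, hy, z, hz, h⟩
  · specialize hFX x
    rcases hx with rfl | hx <;> rcases hy with rfl | hy <;> rcases hz with rfl | hz <;> grind
  · specialize hXF x
    rcases hx with rfl | hx <;> rcases hy with rfl | hy <;> rcases hz with rfl | hz <;> grind

theorem exists_alternation_of_mem {α : Type*} [LinearOrder α] {T X F : Set α} {p : α}
    (hFX : NoAlternation T F X) (hXF : NoAlternation T X F) (hp : p ∉ T)
    (h : ¬ (NoAlternation (insert p T) F (insert p X) ∧
      NoAlternation (insert p T) (insert p X) F)) :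
    p ∉ F ∧ ∃ u ∈ T, ∃ v ∈ T, u ∉ X ∧ u ∈ F ∧
      ((u < p ∧ p < v ∧ v ∉ X ∧ v ∈ F) ∨ (p < u ∧ u < v ∧ v ∉ F ∧ v ∈ X) ∨
        (v < u ∧ u < p ∧ v ∉ F ∧ v ∈ X)) := by
  unfold NoAlternation at *
  rw [not_and_or] at h
  push Not at h
  simp only [Set.mem_insert_iff] at h
  rcases h with ⟨x, hx, y, hy, z, hz, h⟩ | ⟨x, hx, y, hy, z, hz, h⟩
  · specialize hFX x
    rcases hx with rfl | hx <;> rcases hy with rfl | hy <;> rcases hz with rfl | hz <;> grind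
  · specialize hXF x
    rcases hx with rfl | hx <;> rcases hy with rfl | hy <;> rcases hz with rfl | hz <;> grind

/-- A set compatible with an ABA-free family on `T` stays compatible on `insert p T` for one of the
two choices at the new vertex `p`. -/
theorem CompatibleOn.exists_insert {α : Type*} [LinearOrder α] {𝓕 : Set (Set α)} {T X : Set α}
    {p : α} (h𝓕 : ∀ F ∈ 𝓕, ∀ G ∈ 𝓕, NoAlternation (insert p T) F G)
    (hX : CompatibleOn 𝓕 T X) (hp : p ∉ T) :
    ∃ Y, (∀ t ∈ T, t ∈ Y ↔ t ∈ X) ∧ CompatibleOn 𝓕 (insert p T) Y := by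
  by_cases h₁ : CompatibleOn 𝓕 (insert p T) (X \ {p})
  · exact ⟨_, fun t ht => by grind, h₁⟩
  by_cases h₂ : CompatibleOn 𝓕 (insert p T) (insert p X)
  · exact ⟨_, fun t ht => by grind, h₂⟩
  exfalso
  unfold CompatibleOn at h₁ h₂
  push Not at h₁ h₂
  obtain ⟨F, hF, hF'⟩ := h₁
  obtain ⟨G, hG, hG'⟩ := h₂
  obtain ⟨hpF, u, hu, v, hv, huX, huF, h⟩ :=
    exists_alternation_of_not_mem (hX F hF).1 (hX F hF).2 hp (fun h => hF' h.1 h.2)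
  obtain ⟨hpG, u', hu', v', hv', huX', huG', h'⟩ :=
    exists_alternation_of_mem (hX G hG).1 (hX G hG).2 hp (fun h => hG' h.1 h.2)
  obtain ⟨hFX, hXF⟩ := hX F hF
  obtain ⟨hGX, hXG⟩ := hX G hG
  have hFG := h𝓕 F hF G hG
  have hGF := h𝓕 G hG F hF
  have hpT : p ∈ insert p T := Set.mem_insert _ _
  have hT : ∀ t ∈ T, t ∈ insert p T := fun t ht => Set.mem_insert_of_mem _ ht
  -- Here `p ∈ F \ G`. In each pair of positions, either `X` already alternates with `F` or `G`
  -- inside `T`, or `F` and `G` form an ABA through `p`.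
  rcases h with h | h | h <;> rcases h' with h' | h' | h'
  · have := hXF u hu u' hu' v hv
    have := hGX u' hu' u hu v' hv'
    have := hXF u hu v' hv' v hv
    have := hGX u' hu' v hv v' hv'
    have := hGF u (hT u hu) p hpT v (hT v hv)
    have := hGF u (hT u hu) p hpT v' (hT v' hv')
    have := hGF u' (hT u' hu') p hpT v (hT v hv)
    have := hGF u' (hT u' hu') p hpT v' (hT v' hv')
    clear hFX hXF hGX hXG hFG hGF hT hF' hG' h𝓕 hX
    grind +splitImp
  · have := hXG u hu u' hu' v' hv'
    have := hXF u hu u' hu' v hv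
    have := hXG v hv u' hu' v' hv'
    have := hGF u (hT u hu) p hpT v (hT v hv)
    have := hGF u (hT u hu) p hpT u' (hT u' hu')
    clear hFX hXF hGX hXG hFG hGF hT hF' hG' h𝓕 hX
    grind +splitImp
  · have := hXG v' hv' u' hu' v hv
    have := hXF u hu u' hu' v hv
    have := hXG v' hv' u' hu' u hu
    have := hGF u (hT u hu) p hpT v (hT v hv)
    have := hGF u' (hT u' hu') p hpT v (hT v hv)
    clear hFX hXF hGX hXG hFG hGF hT hF' hG' h𝓕 hX
    grind +splitImp
  · have := hFX u' hu' u hu v hv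
    have := hGX u' hu' u hu v' hv'
    have := hFX v' hv' u hu v hv
    have := hGF u' (hT u' hu') p hpT v' (hT v' hv')
    have := hGF u' (hT u' hu') p hpT u (hT u hu)
    clear hFX hXF hGX hXG hFG hGF hT hF' hG' h𝓕 hX
    grind +splitImp
  · have := hFX u' hu' u hu v hv
    have := hXG u hu u' hu' v' hv'
    have := hXF u hu v hv v' hv'
    have := hGX u' hu' v' hv' v hv
    have := hFG p hpT u (hT u hu) v (hT v hv)
    have := hFG p hpT u (hT u hu) v' (hT v' hv')
    have := hFG p hpT u' (hT u' hu') v (hT v hv)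
    have := hFG p hpT u' (hT u' hu') v' (hT v' hv')
    clear hFX hXF hGX hXG hFG hGF hT hF' hG' h𝓕 hX
    grind +splitImp
  · have := hFX u' hu' u hu v hv
    have := hXG v' hv' u' hu' u hu
    have := hGF u' (hT u' hu') p hpT u (hT u hu)
    clear hFX hXF hGX hXG hFG hGF hT hF' hG' h𝓕 hX
    grind +splitImp
  · have := hFX v hv u hu v' hv'
    have := hGX u' hu' u hu v' hv'
    have := hFX v hv u hu u' hu'
    have := hGF u' (hT u' hu') p hpT v' (hT v' hv')
    have := hGF u (hT u hu) p hpT v' (hT v' hv')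
    clear hFX hXF hGX hXG hFG hGF hT hF' hG' h𝓕 hX
    grind +splitImp
  · have := hFX v hv u hu u' hu'
    have := hXG u hu u' hu' v' hv'
    have := hGF u (hT u hu) p hpT u' (hT u' hu')
    clear hFX hXF hGX hXG hFG hGF hT hF' hG' h𝓕 hX
    grind +splitImp
  · have := hFX v hv u hu u' hu'
    have := hXG v' hv' u' hu' u hu
    have := hXF v' hv' v hv u hu
    have := hGX v hv v' hv' u' hu'
    have := hFG v (hT v hv) u (hT u hu) p hpT
    have := hFG v' (hT v' hv') u (hT u hu) p hpT
    have := hFG v (hT v hv) u' (hT u' hu') p hpT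
    have := hFG v' (hT v' hv') u' (hT u' hu') p hpT
    clear hFX hXF hGX hXG hFG hGF hT hF' hG' h𝓕 hX
    grind +splitImp

theorem CompatibleOn.exists_extend {α : Type*} [LinearOrder α] {𝓕 : Set (Set α)} {S T X : Set α}
    (hS : S.Finite) (h𝓕 : ∀ F ∈ 𝓕, ∀ G ∈ 𝓕, NoAlternation S F G) (hTS : T ⊆ S)
    (hX : CompatibleOn 𝓕 T X) :
    ∃ Y, (∀ t ∈ T, t ∈ Y ↔ t ∈ X) ∧ CompatibleOn 𝓕 S Y := by
  have key : ∀ U : Set α, U.Finite → U ⊆ S →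
      ∃ Y, (∀ t ∈ T, t ∈ Y ↔ t ∈ X) ∧ CompatibleOn 𝓕 (U ∪ T) Y := by
    intro U hU
    induction U, hU using Set.Finite.induction_on with
    | empty => exact fun _ => ⟨X, fun _ _ => Iff.rfl, by simpa using hX⟩
    | @insert p U _ _ ih =>
      intro hUS
      obtain ⟨Y, hY, hYc⟩ := ih ((Set.subset_insert _ _).trans hUS)
      by_cases hp : p ∈ U ∪ T
      · exact ⟨Y, hY, by rwa [Set.insert_union, Set.insert_eq_of_mem hp]⟩
      have hsub : insert p (U ∪ T) ⊆ S := by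
        rw [← Set.insert_union]
        exact Set.union_subset hUS hTS
      obtain ⟨Z, hZ, hZc⟩ := hYc.exists_insert
        (fun F hF G hG => (h𝓕 F hF G hG).mono hsub) hp
      refine ⟨Z, fun t ht => (hZ t (Or.inr ht)).trans (hY t ht), ?_⟩
      rwa [Set.insert_union]
  obtain ⟨Y, hY, hYc⟩ := key S hS subset_rfl
  exact ⟨Y, hY, by rwa [Set.union_eq_self_of_subset_right hTS] at hYc⟩

/-! ### Transport between alternating triples -/

/-- Some member of `𝓕` has the same trace as `A` on the three given vertices. -/
def Realizes {α : Type*} (𝓕 : Set (Set α)) (A : Set α) (x y z : α) : Prop :=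
  ∃ F ∈ 𝓕, (x ∈ F ↔ x ∈ A) ∧ (y ∈ F ↔ y ∈ A) ∧ (z ∈ F ↔ z ∈ A)

/-- The vertices `x < y < z` of `T` alternate between `A` and its complement. -/
structure IsAlternating {α : Type*} [LinearOrder α] (T A : Set α) (x y z : α) : Prop where
  left_mem : x ∈ T
  middle_mem : y ∈ T
  right_mem : z ∈ T
  left_lt : x < y
  lt_right : y < z
  left_iff : x ∈ A ↔ y ∉ A
  right_iff : z ∈ A ↔ y ∉ A

/-- Every four vertices of `T` are split by some member of `𝓕` in the way `A` splits them. -/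
def SplitsFour {α : Type*} (𝓕 : Set (Set α)) (T A : Set α) : Prop :=
  ∀ a ∈ T, ∀ b ∈ T, ∀ c ∈ T, ∀ d ∈ T, ∃ F ∈ 𝓕,
    ((a ∈ F ↔ a ∈ A) ∧ (b ∈ F ↔ b ∈ A) ∧ (c ∈ F ↔ c ∈ A) ∧ (d ∈ F ↔ d ∈ A)) ∨
    ((a ∈ F ↔ a ∉ A) ∧ (b ∈ F ↔ b ∉ A) ∧ (c ∈ F ↔ c ∉ A) ∧ (d ∈ F ↔ d ∉ A))

section Transport

variable {α : Type*} [LinearOrder α] {𝓕 : Set (Set α)} {T A : Set α}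

theorem IsAlternating.not_realizes (h𝓕 : ∀ F ∈ 𝓕, ∀ G ∈ 𝓕, NoAlternation T F G) {x y z : α}
    (h : IsAlternating T A x y z) (hr : Realizes 𝓕 A x y z) {F : Set α} (hF : F ∈ 𝓕)
    (hx : x ∈ F ↔ x ∉ A) (hy : y ∈ F ↔ y ∉ A) (hz : z ∈ F ↔ z ∉ A) : False := by
  obtain ⟨G, hG, gx, gy, gz⟩ := hr
  obtain ⟨h1, h2, h3, h4, h5, h6, h7⟩ := h
  have := h𝓕 F hF G hG x h1 y h2 z h3 h4 h5
  have := h𝓕 G hG F hF x h1 y h2 z h3 h4 h5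
  grind

/-- The member splitting `x, y, z, w` cannot be opposite to `A`, as it would form an ABA with the
one realizing `x, y, z`. So it agrees with `A` on all four. -/
theorem Realizes.of_splitsFour (h𝓕 : ∀ F ∈ 𝓕, ∀ G ∈ 𝓕, NoAlternation T F G)
    (hsplit : SplitsFour 𝓕 T A) {x y z x' y' z' w : α} (h : IsAlternating T A x y z)
    (hr : Realizes 𝓕 A x y z) (hw : w ∈ T)
    (hx' : x' = x ∨ x' = y ∨ x' = z ∨ x' = w) (hy' : y' = x ∨ y' = y ∨ y' = z ∨ y' = w)
    (hz' : z' = x ∨ z' = y ∨ z' = z ∨ z' = w) : Realizes 𝓕 A x' y' z' := by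
  obtain ⟨F, hF, ⟨h1, h2, h3, h4⟩ | ⟨h1, h2, h3, -⟩⟩ :=
    hsplit x h.left_mem y h.middle_mem z h.right_mem w hw
  · refine ⟨F, hF, ?_, ?_, ?_⟩
    · rcases hx' with rfl | rfl | rfl | rfl <;> assumption
    · rcases hy' with rfl | rfl | rfl | rfl <;> assumption
    · rcases hz' with rfl | rfl | rfl | rfl <;> assumption
  · exact (h.not_realizes h𝓕 hr hF h1 h2 h3).elim

theorem Realizes.of_left_iff (h𝓕 : ∀ F ∈ 𝓕, ∀ G ∈ 𝓕, NoAlternation T F G)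
    (hsplit : SplitsFour 𝓕 T A) {x y z x' y' z' : α} (h : IsAlternating T A x y z)
    (hr : Realizes 𝓕 A x y z) (h' : IsAlternating T A x' y' z') (hxx' : x ∈ A ↔ x' ∈ A) :
    Realizes 𝓕 A x' y' z' := by
  obtain ⟨h1, h2, h3, h4, h5, h6, h7⟩ := id h
  obtain ⟨h1', h2', h3', h4', h5', h6', h7'⟩ := id h'
  -- Taking the earlier left end and the later right end leaves room to swap `y` for `y'` while
  -- every intermediate triple still alternates.
  obtain ⟨u, hu, hux, hux', huA⟩ : ∃ u ∈ T, u ≤ x ∧ u ≤ x' ∧ (u ∈ A ↔ x ∈ A) := by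
    rcases le_total x x' with hle | hle
    · exact ⟨x, h1, le_rfl, hle, Iff.rfl⟩
    · exact ⟨x', h1', hle, le_rfl, hxx'.symm⟩
  obtain ⟨v, hv, hvz, hvz', hvA⟩ : ∃ v ∈ T, z ≤ v ∧ z' ≤ v ∧ (v ∈ A ↔ x ∈ A) := by
    rcases le_total z z' with hle | hle
    · exact ⟨z', h3', hle, le_rfl, h7'.trans (h6'.symm.trans hxx'.symm)⟩
    · exact ⟨z, h3, le_rfl, hle, h7.trans h6.symm⟩
  have a1 : IsAlternating T A u y z := ⟨hu, h2, h3, hux.trans_lt h4, h5, huA.trans h6, h7⟩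
  have a2 : IsAlternating T A u y v :=
    ⟨hu, h2, hv, hux.trans_lt h4, h5.trans_le hvz, huA.trans h6, hvA.trans h6⟩
  have a3 : IsAlternating T A u y' v :=
    ⟨hu, h2', hv, hux'.trans_lt h4', h5'.trans_le hvz', huA.trans (hxx'.trans h6'),
      hvA.trans (hxx'.trans h6')⟩
  have a4 : IsAlternating T A x' y' v :=
    ⟨h1', h2', hv, h4', h5'.trans_le hvz', h6',
      hvA.trans (hxx'.trans h6')⟩
  have r1 : Realizes 𝓕 A u y z := hr.of_splitsFour h𝓕 hsplit h hu (by simp) (by simp) (by simp)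
  have r2 : Realizes 𝓕 A u y v := r1.of_splitsFour h𝓕 hsplit a1 hv (by simp) (by simp) (by simp)
  have r3 : Realizes 𝓕 A u y' v :=
    r2.of_splitsFour h𝓕 hsplit a2 h2' (by simp) (by simp) (by simp)
  have r4 : Realizes 𝓕 A x' y' v :=
    r3.of_splitsFour h𝓕 hsplit a3 h1' (by simp) (by simp) (by simp)
  exact r4.of_splitsFour h𝓕 hsplit a4 h3' (by simp) (by simp) (by simp)

theorem Realizes.of_isAlternating (h𝓕 : ∀ F ∈ 𝓕, ∀ G ∈ 𝓕, NoAlternation T F G)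
    (hsplit : SplitsFour 𝓕 T A) {x y z x' y' z' : α} (h : IsAlternating T A x y z)
    (hr : Realizes 𝓕 A x y z) (h' : IsAlternating T A x' y' z') :
    Realizes 𝓕 A x' y' z' := by
  by_cases hxx' : x ∈ A ↔ x' ∈ A
  · exact hr.of_left_iff h𝓕 hsplit h h' hxx'
  obtain ⟨h1, h2, h3, h4, h5, h6, h7⟩ := id h
  obtain ⟨h1', h2', h3', h4', h5', h6', h7'⟩ := id h'
  rcases lt_trichotomy x x' with hlt | rfl | hlt
  -- Opposite types at the left ends: prepending the earlier end to the other triple gives a bridge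
  -- that alternates.
  · have a : IsAlternating T A x x' y' := ⟨h1, h1', h2', hlt, h4', by tauto, by tauto⟩
    exact (hr.of_left_iff h𝓕 hsplit h a Iff.rfl).of_splitsFour h𝓕 hsplit a h3'
      (by simp) (by simp) (by simp)
  · exact absurd Iff.rfl hxx'
  · have a : IsAlternating T A x' x y := ⟨h1', h1, h2, hlt, h4, by tauto, by tauto⟩
    have r : Realizes 𝓕 A x' x y :=
      hr.of_splitsFour h𝓕 hsplit h h1' (by simp) (by simp) (by simp)
    exact r.of_left_iff h𝓕 hsplit a h' Iff.rfl

theorem SplitsFour.compatibleOn_or_compl (h𝓕 : ∀ F ∈ 𝓕, ∀ G ∈ 𝓕, NoAlternation T F G)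
    (hsplit : SplitsFour 𝓕 T A) : CompatibleOn 𝓕 T A ∨ CompatibleOn 𝓕 T Aᶜ := by
  by_contra hcon
  push Not at hcon
  obtain ⟨hA, hAc⟩ := hcon
  obtain ⟨F, hF, x, y, z, h, hx, hy, hz⟩ : ∃ F ∈ 𝓕, ∃ x y z, IsAlternating T A x y z ∧
      (x ∈ F ↔ x ∉ A) ∧ (y ∈ F ↔ y ∉ A) ∧ (z ∈ F ↔ z ∉ A) := by
    by_contra hno
    refine hA fun F hF => ⟨?_, ?_⟩ <;> intro x hx y hy z hz hxy hyz h1 h2 h3 h4 h5 h6 <;>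
      exact hno ⟨F, hF, x, y, z, ⟨hx, hy, hz, hxy, hyz, by tauto, by tauto⟩,
        by tauto, by tauto, by tauto⟩
  obtain ⟨x', y', z', h', hr⟩ : ∃ x y z, IsAlternating T A x y z ∧ Realizes 𝓕 A x y z := by
    by_contra hno
    refine hAc fun F hF => ⟨?_, ?_⟩ <;> intro x hx y hy z hz hxy hyz h1 h2 h3 h4 h5 h6 <;>
      rw [Set.mem_compl_iff] at * <;>
      exact hno ⟨x, y, z, ⟨hx, hy, hz, hxy, hyz, by tauto, by tauto⟩,
        F, hF, by tauto, by tauto, by tauto⟩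
  exact h.not_realizes h𝓕 (hr.of_isAlternating h𝓕 hsplit h' h) hF hx hy hz

end Transport

/-! ### Back to hypergraphs -/

theorem noAlternation_of_isABAFree {α : Type*} [LinearOrder α] {K : Hypergraph α}
    (hK : K.IsABAFree) (T : Set α) : ∀ F ∈ K.edgeSet, ∀ G ∈ K.edgeSet, NoAlternation T F G :=
  fun F hF G hG x _ y _ z _ hxy hyz h1 h2 h3 h4 h5 h6 =>
    hK ⟨F, hF, G, hG, x, ⟨h1, h2⟩, y, ⟨h3, h4⟩, z, ⟨h5, h6⟩, hxy, hyz⟩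

/-- Adding a compatible set of vertices to the hyperedges of an ABA-free hypergraph keeps it
ABA-free, so the same set can be added to every pseudohalfplane hypergraph it witnesses. -/
theorem exists_isPseudohalfplane_insert {α : Type*} [LinearOrder α] {H K : Hypergraph α}
    (hV : K.vertexSet = H.vertexSet) (hK : K.IsABAFree)
    (hHK : H.edgeSet ⊆ K.edgeSet ∪ K.complements.edgeSet) {X : Set α} (hX : X ⊆ H.vertexSet)
    (hc : CompatibleOn K.edgeSet H.vertexSet X) :
    ∃ H' : Hypergraph α, H'.IsPseudohalfplane ∧ H'.vertexSet = H.vertexSet ∧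
      H'.edgeSet = insert X H.edgeSet := by
  let H' : Hypergraph α :=
    { vertexSet := H.vertexSet
      edgeSet := insert X H.edgeSet
      subset_vertexSet_of_mem_edgeSet' := by
        rintro e (rfl | he)
        · exact hX
        · exact H.subset_vertexSet_of_mem_edgeSet' he }
  let K' : Hypergraph α :=
    { vertexSet := H.vertexSet
      edgeSet := insert X K.edgeSet
      subset_vertexSet_of_mem_edgeSet' := by
        rintro e (rfl | he)
        · exact hX
        · exact hV ▸ K.subset_vertexSet_of_mem_edgeSet' he }
  refine ⟨H', ⟨K', rfl, ?_, ?_⟩, rfl, rfl⟩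
  · have hmem : ∀ e ∈ K.edgeSet, e ⊆ H.vertexSet :=
      fun e he => hV ▸ K.subset_vertexSet_of_mem_edgeSet' he
    rintro ⟨P, hP, Q, hQ, x, hx, y, hy, z, hz, hxy, hyz⟩
    rcases hP with rfl | hP <;> rcases hQ with rfl | hQ
    · exact hx.2 hx.1
    · exact (hc Q hQ).2 x (hX hx.1) y (hmem Q hQ hy.1) z (hX hz.1) hxy hyz
        hx.1 hx.2 hy.1 hy.2 hz.1 hz.2
    · exact (hc P hP).1 x (hmem P hP hx.1) y (hX hy.1) z (hmem P hP hz.1) hxy hyz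
        hx.1 hx.2 hy.1 hy.2 hz.1 hz.2
    · exact hK ⟨P, hP, Q, hQ, x, hx, y, hy, z, hz, hxy, hyz⟩
  · rintro e (rfl | he)
    · exact Or.inl (Or.inl rfl)
    · rcases hHK he with he | ⟨F, hF, rfl⟩
      · exact Or.inl (Or.inr he)
      · exact Or.inr ⟨F, Or.inr hF, by rw [hV]⟩

/-- Replacing a complement by the hyperedge of `K` it comes from only swaps the two sides, which
`SplitsFour` allows. -/
theorem splitsFour_of_separates {α : Type*} {H K : Hypergraph α}
    (hV : K.vertexSet = H.vertexSet)
    (hHK : H.edgeSet ⊆ K.edgeSet ∪ K.complements.edgeSet)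
    {A B : Set α} (hA : A ⊆ H.vertexSet) (hB : B ⊆ H.vertexSet)
    (hsep : ∀ D : Set α, D ⊆ H.vertexSet → D.ncard ≤ 4 →
      ∃ X ∈ H.edgeSet, Separates X (A ∩ D) (B ∩ D)) :
    SplitsFour K.edgeSet (A ∪ B) A := by
  intro a ha b hb c hc d hd
  have hsub : ({a, b, c, d} : Set α) ⊆ A ∪ B := by
    rintro t (rfl | rfl | rfl | rfl) <;> assumption
  have hcard : ({a, b, c, d} : Set α).ncard ≤ 4 := by
    classical
    have h := Finset.card_le_four (a := a) (b := b) (c := c) (d := d)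
    rw [← Set.ncard_coe_finset] at h
    simpa using h
  obtain ⟨X, hX, -, hXs⟩ := hsep _ (hsub.trans (Set.union_subset hA hB)) hcard
  have hside : (∀ t ∈ ({a, b, c, d} : Set α), t ∈ X ↔ t ∈ A) ∨
      (∀ t ∈ ({a, b, c, d} : Set α), t ∈ X ↔ t ∉ A) := by
    rcases hXs with ⟨h1, h2⟩ | ⟨h1, h2⟩
    · refine Or.inl fun t ht => ⟨fun htX => ?_, fun htA => h1 ⟨htA, ht⟩⟩
      rcases hsub ht with h | h
      · exact h
      · exact (h2.le ⟨htX, h, ht⟩).elim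
    · refine Or.inr fun t ht => ⟨fun htX htA => h1.le ⟨htX, htA, ht⟩, fun htA => ?_⟩
      exact h2 ⟨(hsub ht).resolve_left htA, ht⟩
  have hside' : ∃ F ∈ K.edgeSet, (∀ t ∈ ({a, b, c, d} : Set α), t ∈ F ↔ t ∈ A) ∨
      (∀ t ∈ ({a, b, c, d} : Set α), t ∈ F ↔ t ∉ A) := by
    rcases hHK hX with hX | ⟨F, hF, rfl⟩
    · exact ⟨X, hX, hside⟩
    · have hVt : ∀ t ∈ ({a, b, c, d} : Set α), t ∈ K.vertexSet :=
        fun t ht => hV ▸ Set.union_subset hA hB (hsub ht)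
      simp only [Set.mem_sdiff] at hside
      refine ⟨F, hF, hside.symm.imp (fun h t ht => ?_) (fun h t ht => ?_)⟩
      all_goals
        have := h t ht
        have := hVt t ht
        tauto
  obtain ⟨F, hF, h | h⟩ := hside'
  · exact ⟨F, hF, Or.inl ⟨h a (by simp), h b (by simp), h c (by simp), h d (by simp)⟩⟩
  · exact ⟨F, hF, Or.inr ⟨h a (by simp), h b (by simp), h c (by simp), h d (by simp)⟩⟩

theorem theorem3p9 {α : Type*} [LinearOrder α] (H : Hypergraph α)
    (hfin : H.vertexSet.Finite) (hH : H.IsPseudohalfplane)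
    (A B : Set α) (hA : A ⊆ H.vertexSet) (hB : B ⊆ H.vertexSet)
    (hsep : ∀ D : Set α, D ⊆ H.vertexSet → D.ncard ≤ 4 →
      ∃ X ∈ H.edgeSet, Separates X (A ∩ D) (B ∩ D)) :
    (∃ X ∈ H.edgeSet, Separates X A B) ∨
      ∃ (X : Set α) (H' : Hypergraph α), X ∉ H.edgeSet ∧ H.IsExtension H' ∧
        H'.edgeSet = insert X H.edgeSet ∧ Separates X A B := by
  obtain ⟨K, hV, hK, hHK⟩ := hH
  have hAB : Disjoint A B := by
    rw [Set.disjoint_left]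
    intro t htA htB
    obtain ⟨_, _, h, -⟩ := hsep {t} (by simpa using hA htA) (by simp)
    exact h.le ⟨⟨htA, rfl⟩, htB, rfl⟩
  have hABS : A ∪ B ⊆ H.vertexSet := Set.union_subset hA hB
  have hKS := noAlternation_of_isABAFree hK H.vertexSet
  have hsplit := splitsFour_of_separates hV hHK hA hB hsep
  obtain ⟨X, hXS, hXc, hXsep⟩ : ∃ X ⊆ H.vertexSet,
      CompatibleOn K.edgeSet H.vertexSet X ∧ Separates X A B := by
    -- The extended set may contain points outside the vertex set, notably when it starts from `Aᶜ`;
    -- trimming them does not affect compatibility.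
    have hrestrict : ∀ Y, CompatibleOn K.edgeSet H.vertexSet Y →
        CompatibleOn K.edgeSet H.vertexSet (Y ∩ H.vertexSet) := by
      intro Y hY F hF
      have h := hY F hF
      unfold NoAlternation at *
      constructor
      · intro x hx y hy z hz
        have := h.1 x hx y hy z hz
        grind
      · intro x hx y hy z hz
        have := h.2 x hx y hy z hz
        grind
    have hdis := Set.disjoint_left.1 hAB
    rcases hsplit.compatibleOn_or_compl (noAlternation_of_isABAFree hK _) with h | h
    · obtain ⟨Y, hY, hYc⟩ := h.exists_extend hfin hKS hABS
      refine ⟨Y ∩ H.vertexSet, Set.inter_subset_right, hrestrict Y hYc, hAB.inter_eq, Or.inl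
        ⟨fun t ht => ⟨(hY t (Or.inl ht)).2 ht, hA ht⟩, Set.eq_empty_of_forall_notMem ?_⟩⟩
      rintro t ⟨⟨htY, -⟩, htB⟩
      exact hdis ((hY t (Or.inr htB)).1 htY) htB
    · obtain ⟨Y, hY, hYc⟩ := h.exists_extend hfin hKS hABS
      refine ⟨Y ∩ H.vertexSet, Set.inter_subset_right, hrestrict Y hYc, hAB.inter_eq, Or.inr
        ⟨Set.eq_empty_of_forall_notMem ?_, fun t ht =>
          ⟨(hY t (Or.inr ht)).2 fun htA => hdis htA ht, hB ht⟩⟩⟩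
      rintro t ⟨⟨htY, -⟩, htA⟩
      exact (hY t (Or.inl htA)).1 htY htA
  by_cases hXH : X ∈ H.edgeSet
  · exact Or.inl ⟨X, hXH, hXsep⟩
  · obtain ⟨H', hH', hV', hE⟩ := exists_isPseudohalfplane_insert hV hK hHK hXS hXc
    exact Or.inr ⟨X, H', hXH, ⟨hH', hV', hE ▸ Set.ssubset_insert hXH⟩, hE, hXsep⟩
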